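/- Setting. Let $A,B,T>0$, $\lambda\ge 0$, $\rho,\theta\in[0,1]$ and $\mu,\alpha,\sigma,\beta\in\mathbb R$. Let $Y$, $X_1,X_2,\dots$ and $Z_1,Z_2,\dots$ be standard Brownian motions, $N$ a Poisson process with intensity $\lambda$, and $\xi_1,\xi_2,\dots$ nonnegative identically distributed random variables, all of these being independent. Put $S_k=\sum_{j=1}^k\xi_j$ and $J_t=S_{N_t}$. In a portfolio of identical loans, the assets and the liabilities of loan $i$ are $$A_{it}=A\exp\Big(\big(\mu+\lambda(1-\mathbb E[e^{-\xi_1}])-\tfrac12\sigma^2\big)t+\sigma\big(\sqrt{\rho}\,Y_t+\sqrt{1-\rho}\,X_{it}\big)-J_t\Big),$$ $$B_{it}=B\exp\Big(\big(\alpha-\tfrac12\beta^2\big)t+\beta\big(\sqrt{\theta}\,Y_t+\sqrt{1-\theta}\,Z_{it}\big)\Big),$$ and the percentage loss of the first $n$ loans is $L^{(n)}=\frac1n\sum_{i=1}^n 1_{(0,1)}(A_{iT}/B_{iT})$. Let $\Phi$ be the standard normal distribution function and put $$\Lambda=\sigma\sqrt\rho-\beta\sqrt\theta,\qquad \zeta=\sqrt{\sigma^2(1-\rho)+\beta^2(1-\theta)},\qquad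 \Sigma=\sqrt{\sigma^2+\beta^2-2\sigma\beta\sqrt{\rho\theta}},$$ $$\Xi=\ln\frac BA-\Big(\mu-\alpha-\tfrac12(\sigma^2-\beta^2)\Big)T,\qquad \tilde p=\Phi\Big(\frac{\Xi-\lambda(1-\mathbb E[e^{-\xi_1}])T}{\Sigma\sqrt T}\Big).$$ Assume $\zeta>0$. Statement. The limit $\bar L=\lim_{n\to\infty}L^{(n)}$ exists almost surely, and $\bar L\in(0,1)$ almost surely. For every $k\ge 0$ the law $\mathbb P[S_k\in du]$ is the $k$-fold convolution of the law of $\xi_1$; if $\xi_1$ has a density $g$, then $S_k$ has, for every $k\ge1$, the density $g\ast\cdots\ast g$ ($k$ factors). (a) If $\Lambda=0$, then for every $x\in(0,1)$ $$\mathbb P[\bar L\le x]=e^{-\lambda T}\chi_{[\tilde p,1]}(x)+\sum_{k=1}^\infty e^{-\lambda T}\frac{(\lambda T)^k}{k!}\int_{[0,M_T]}\mathbb P[S_k\in du],\qquad M_T=\Sigma\sqrt T\big(\Phi^{-1}(x)-\Phi^{-1}(\tilde p)\big),$$ where $[0,M_T]=\emptyset$ if $M_T<0$. (b) If $\Lambda\ne0$,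 put $$H(x,u)=\frac1{|\Lambda|}\Big(\zeta\Phi^{-1}(x)-\Sigma\Phi^{-1}(\tilde p)-\frac u{\sqrt T}\Big).$$ Then for every $x\in(0,1)$ $$\mathbb P[\bar L\le x]=e^{-\lambda T}\Phi(H(x,0))+\sum_{k=1}^\infty e^{-\lambda T}\frac{(\lambda T)^k}{k!}\int_{[0,\infty)}\Phi(H(x,u))\,\mathbb P[S_k\in du],$$ and the law of $\bar L$ has on $(0,1)$ the density $$\hat f(x)=\frac{\zeta}{|\Lambda|}\int_{[0,\infty)}\sum_{k=1}^\infty e^{-\lambda T}\frac{(\lambda T)^k}{k!}\,\frac{\Phi'(H(x,u))}{\Phi'(\Phi^{-1}(x))}\,\mathbb P[S_k\in du]+e^{-\lambda T}\frac{\zeta}{|\Lambda|}\,\frac{\Phi'(H(x,0))}{\Phi'(\Phi^{-1}(x))}.$$ Here the integral of the sum is taken with respect to the measure $\sum_{k\ge1}e^{-\lambda T}\frac{(\lambda T)^k}{k!}\mathbb P[S_k\in du]$. -/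

import Mathlib

open MeasureTheory ProbabilityTheory Set Filter Topology
open scoped NNReal ENNReal

noncomputable section

namespace LoanPortfolio

/-! ### The standard normal law -/

/-- `Φ`, the standard normal distribution function. -/
def stdNormalCDF (z : ℝ) : ℝ := cdf (gaussianReal 0 1) z

/-- `Φ'`, the standard normal density. -/
def stdNormalPDF (z : ℝ) : ℝ := gaussianPDFReal 0 1 z

/-- `Φ⁻¹`, the standard normal quantile function; on `(0, 1)` it is the inverse of `Φ`, and it is
only used there. -/
def stdNormalQuantile (x : ℝ) : ℝ := sInf {z : ℝ | x ≤ stdNormalCDF z}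

/-! ### Poisson processes and convolution powers -/

/-- `N` is a Poisson process with intensity `r`: it starts at `0`, its paths are nondecreasing and
right-continuous, and its increments are independent and Poisson distributed. (As the paths are
nondecreasing, the subtraction of natural numbers below is the true one.) -/
structure IsPoissonProcess {Ω : Type*} [MeasurableSpace Ω] (N : ℝ≥0 → Ω → ℕ) (r : ℝ≥0)
    (P : Measure Ω) : Prop where
  measurable : ∀ t, Measurable (N t)
  start : ∀ᵐ ω ∂P, N 0 ω = 0
  mono : ∀ᵐ ω ∂P, Monotone fun t => N t ω
  rightCont : ∀ᵐ ω ∂P, ∀ t, ContinuousWithinAt (fun s => N s ω) (Ici t) t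
  indepIncrements : HasIndepIncrements (fun t ω => (N t ω : ℝ)) P
  lawIncrements : ∀ s t : ℝ≥0, s ≤ t →
    HasLaw (fun ω => N t ω - N s ω) (poissonMeasure (r * (t - s))) P

/-- The `k`-fold convolution of a measure on the line with itself. -/
def convPow (ν : Measure ℝ) : ℕ → Measure ℝ
  | 0 => Measure.dirac 0
  | k + 1 => Measure.conv (convPow ν k) ν

/-- `densityConvPow g k` is the convolution `g ∗ ⋯ ∗ g` of `k + 1` copies of the density `g`. -/
def densityConvPow (g : ℝ → ℝ≥0∞) : ℕ → ℝ → ℝ≥0∞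
  | 0 => g
  | k + 1 => lconvolution (densityConvPow g k) g volume

/-! ### The model -/

/-- The parameters of a portfolio of identical loans. -/
structure Params where
  /-- initial value of the assets -/
  A₀ : ℝ
  /-- initial value of the liabilities -/
  B₀ : ℝ
  /-- drift of the assets -/
  μ : ℝ
  /-- volatility of the assets -/
  σ : ℝ
  /-- drift of the liabilities -/
  α : ℝ
  /-- volatility of the liabilities -/
  β : ℝ
  /-- correlation coefficient of the assets -/
  ρ : ℝ
  /-- correlation coefficient of the liabilities -/
  θ : ℝ
  /-- intensity `λ` of the jumps -/
  lam : ℝ≥0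
  /-- maturity -/
  T : ℝ≥0
  A₀_pos : 0 < A₀
  B₀_pos : 0 < B₀
  ρ_mem : ρ ∈ Icc (0 : ℝ) 1
  θ_mem : θ ∈ Icc (0 : ℝ) 1
  T_pos : 0 < T

/-- The driving factors: the aggregate factor `Y`, the idiosyncratic factors `X i` of the assets
and `Z i` of the liabilities of loan `i`, the counting process `N` of the jumps, and the jump
sizes, `ξ j` being the size of the `(j + 1)`-st jump. -/
structure Factors (Ω : Type*) where
  Y : ℝ≥0 → Ω → ℝ
  X : ℕ → ℝ≥0 → Ω → ℝ
  Z : ℕ → ℝ≥0 → Ω → ℝ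
  N : ℝ≥0 → Ω → ℕ
  ξ : ℕ → Ω → ℝ

/-- Labels for the driving factors. -/
inductive FactorIndex where
  | aggregate : FactorIndex
  | asset : ℕ → FactorIndex
  | liability : ℕ → FactorIndex
  | count : FactorIndex
  | jump : ℕ → FactorIndex

/-- The σ-algebra generated by a driving factor (by its whole path if it is a process). -/
@[reducible] def Factors.sigma {Ω : Type*} (F : Factors Ω) : FactorIndex → MeasurableSpace Ω
  | .aggregate => MeasurableSpace.comap (fun ω t => F.Y t ω) MeasurableSpace.pi
  | .asset i => MeasurableSpace.comap (fun ω t => F.X i t ω) MeasurableSpace.pi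
  | .liability i => MeasurableSpace.comap (fun ω t => F.Z i t ω) MeasurableSpace.pi
  | .count => MeasurableSpace.comap (fun ω t => F.N t ω) MeasurableSpace.pi
  | .jump j => MeasurableSpace.comap (F.ξ j) inferInstance

/-- The probabilistic assumptions on the driving factors: `Y`, `X i`, `Z i` are standard Brownian
motions, `N` is a Poisson process of intensity `lam`, the jump sizes are nonnegative and identically
distributed, and all these factors are independent. -/
structure IsFactorModel {Ω : Type*} [MeasurableSpace Ω] (F : Factors Ω) (lam : ℝ≥0)
    (P : Measure Ω) : Prop where
  measurable_Y : ∀ t, Measurable (F.Y t)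
  measurable_X : ∀ i t, Measurable (F.X i t)
  measurable_Z : ∀ i t, Measurable (F.Z i t)
  measurable_ξ : ∀ j, Measurable (F.ξ j)
  brownian_Y : IsBrownianReal F.Y P
  brownian_X : ∀ i, IsBrownianReal (F.X i) P
  brownian_Z : ∀ i, IsBrownianReal (F.Z i) P
  poisson_N : IsPoissonProcess F.N lam P
  nonneg_ξ : ∀ j, ∀ᵐ ω ∂P, 0 ≤ F.ξ j ω
  identDistrib_ξ : ∀ j, IdentDistrib (F.ξ j) (F.ξ 0) P P
  indep : iIndep F.sigma P

section Dynamics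

variable {Ω : Type*}

/-- The sum `S_k` of the first `k` jump sizes. -/
def jumpSum (F : Factors Ω) (k : ℕ) (ω : Ω) : ℝ := ∑ j ∈ Finset.range k, F.ξ j ω

/-- The compound Poisson process `J`. -/
def compoundPoisson (F : Factors Ω) (t : ℝ≥0) (ω : Ω) : ℝ := jumpSum F (F.N t ω) ω

/-- The compensator `λ (1 - 𝔼[exp (-ξ₁)])`. -/
def compensator [MeasurableSpace Ω] (p : Params) (F : Factors Ω) (P : Measure Ω) : ℝ :=
  p.lam * (1 - ∫ ω, Real.exp (-F.ξ 0 ω) ∂P)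

/-- The assets behind loan `i` at time `t`. -/
def asset [MeasurableSpace Ω] (p : Params) (F : Factors Ω) (P : Measure Ω) (i : ℕ) (t : ℝ≥0)
    (ω : Ω) : ℝ :=
  p.A₀ * Real.exp ((p.μ + compensator p F P - p.σ ^ 2 / 2) * t
    + p.σ * (√p.ρ * F.Y t ω + √(1 - p.ρ) * F.X i t ω) - compoundPoisson F t ω)

/-- The liabilities of loan `i` at time `t`: the geometric Brownian motion with drift `α` and
volatility `β` that starts from `B₀` and is driven by `√θ Y + √(1 - θ) Z i`. -/
def liability (p : Params) (F : Factors Ω) (i : ℕ) (t : ℝ≥0) (ω : Ω) : ℝ :=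
  p.B₀ * Real.exp ((p.α - p.β ^ 2 / 2) * t
    + p.β * (√p.θ * F.Y t ω + √(1 - p.θ) * F.Z i t ω))

/-- The loss on loan `i`: `1` in the case of default at maturity, and `0` otherwise. -/
def loss [MeasurableSpace Ω] (p : Params) (F : Factors Ω) (P : Measure Ω) (i : ℕ) (ω : Ω) : ℝ :=
  (Ioo (0 : ℝ) 1).indicator (fun _ => 1) (asset p F P i p.T ω / liability p F i p.T ω)

/-- The percentage loss on the portfolio of the first `n` loans. -/
def portfolioLoss [MeasurableSpace Ω] (p : Params) (F : Factors Ω) (P : Measure Ω) (n : ℕ)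
    (ω : Ω) : ℝ :=
  1 / n * ∑ i ∈ Finset.range n, loss p F P i ω

/-- The limiting percentage loss `L̄ = lim L` as the number of loans tends to infinity. -/
def limitingLoss [MeasurableSpace Ω] (p : Params) (F : Factors Ω) (P : Measure Ω) (ω : Ω) : ℝ :=
  limUnder atTop fun n => portfolioLoss p F P n ω

end Dynamics

/-! ### The quantities in the limiting distribution -/

/-- `Σ`, with `Σ² = σ² + β² - 2 σ β √(ρ θ)`. -/
def Params.totalVol (p : Params) : ℝ :=
  √(p.σ ^ 2 + p.β ^ 2 - 2 * p.σ * p.β * √(p.ρ * p.θ))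

/-- `ζ`, with `ζ² = σ² (1 - ρ) + β² (1 - θ)`. -/
def Params.idioVol (p : Params) : ℝ :=
  √(p.σ ^ 2 * (1 - p.ρ) + p.β ^ 2 * (1 - p.θ))

/-- `Λ = σ √ρ - β √θ`. -/
def Params.aggVol (p : Params) : ℝ := p.σ * √p.ρ - p.β * √p.θ

/-- `Ξ = log (B₀ / A₀) - (μ - α - (σ² - β²) / 2) T`. -/
def Params.threshold (p : Params) : ℝ :=
  Real.log (p.B₀ / p.A₀) - (p.μ - p.α - (p.σ ^ 2 - p.β ^ 2) / 2) * p.T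

/-- The weight `exp (-λ T) (λ T) ^ k / k!`. -/
def Params.poissonWeight (p : Params) (k : ℕ) : ℝ :=
  Real.exp (-((p.lam : ℝ) * p.T)) * ((p.lam : ℝ) * p.T) ^ k / (Nat.factorial k : ℝ)

section Limit

variable {Ω : Type*} [MeasurableSpace Ω]

/-- `p̃ = Φ ((Ξ - λ (1 - 𝔼[exp (-ξ₁)]) T) / (Σ √T))`. -/
def noJumpProb (p : Params) (F : Factors Ω) (P : Measure Ω) : ℝ :=
  stdNormalCDF ((p.threshold - compensator p F P * p.T) / (p.totalVol * √(p.T : ℝ)))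

/-- The law `P[S_k ∈ du]` of the sum of the first `k` jump sizes. -/
def jumpSumLaw (F : Factors Ω) (P : Measure Ω) (k : ℕ) : Measure ℝ := P.map (jumpSum F k)

/-- The measure `∑_{k ≥ 1} exp (-λ T) (λ T) ^ k / k! P[S_k ∈ du]`. -/
def jumpMixture (p : Params) (F : Factors Ω) (P : Measure Ω) : Measure ℝ :=
  Measure.sum fun k : ℕ => ENNReal.ofReal (p.poissonWeight (k + 1)) • jumpSumLaw F P (k + 1)

/-- `M_T = Σ √T (Φ⁻¹(x) - Φ⁻¹(p̃))`. -/
def jumpBound (p : Params) (F : Factors Ω) (P : Measure Ω) (x : ℝ) : ℝ :=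
  p.totalVol * √(p.T : ℝ) * (stdNormalQuantile x - stdNormalQuantile (noJumpProb p F P))

/-- `H(x, u) = (ζ Φ⁻¹(x) - Σ Φ⁻¹(p̃) - u / √T) / |Λ|`. -/
def H (p : Params) (F : Factors Ω) (P : Measure Ω) (x u : ℝ) : ℝ :=
  1 / |p.aggVol| * (p.idioVol * stdNormalQuantile x
    - p.totalVol * stdNormalQuantile (noJumpProb p F P) - u / √(p.T : ℝ))

/-- The density of the limiting percentage loss at `x ∈ (0, 1)` in the case `Λ ≠ 0`. -/
def limitDensity (p : Params) (F : Factors Ω) (P : Measure Ω) (x : ℝ) : ℝ :=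
  p.idioVol / |p.aggVol| *
      (∫ u in Ici (0 : ℝ), stdNormalPDF (H p F P x u) / stdNormalPDF (stdNormalQuantile x)
        ∂(jumpMixture p F P))
    + p.poissonWeight 0 * (p.idioVol / |p.aggVol|) *
      (stdNormalPDF (H p F P x 0) / stdNormalPDF (stdNormalQuantile x))

end Limit

end LoanPortfolio

end

noncomputable section

namespace LoanPortfolio

/-! ### The standard normal distribution function -/

/-! Taking logarithms, loan `i` defaults exactly when its idiosyncratic noise, built from `X i` and
`Z i`, lies below a level D = Ξ - cT - ΛY_T + J_T common to all loans, where c is the compensator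
(`loss_eq_indicator`). The noises are pairwise independent with law N(0, ζ²T), so the portfolio loss
is their empirical distribution function evaluated at the random level D.

Conditioning on D is avoided: almost surely the empirical distribution functions converge at all
levels at once (`ae_forall_tendsto_empirical`), so D may be substituted pathwise. Hence the limit is
almost surely Φ(D / (ζ√T)) (`IsFactorModel.ae_tendsto_portfolioLoss`).

What remains is the law of D. By independence of the count and the jump sizes, J_T is a Poisson
mixture of the laws of the S_k (`IsFactorModel.map_compoundPoisson`). If Λ = 0, only J_T is random
and the event is J_T ≤ M_T. If Λ ≠ 0, Y_T scales to a standard normal G independent of J_T, the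
event becomes G ≤ H(x, J_T), and Fubini gives the distribution function. The density does not come
from differentiating the series: it follows from the Gaussian density of D given J_T = u, Tonelli
and the substitution x = Φ(v) (`IsFactorModel.map_limitingLoss`). -/

lemma stdNormalPDF_pos (z : ℝ) : 0 < stdNormalPDF z :=
  gaussianPDFReal_pos 0 1 z one_ne_zero

lemma continuous_stdNormalPDF : Continuous stdNormalPDF := by
  unfold stdNormalPDF
  simp only [gaussianPDFReal_def]
  fun_prop

lemma integrable_stdNormalPDF : Integrable stdNormalPDF :=
  integrable_gaussianPDFReal 0 1

lemma stdNormalCDF_eq_integral (z : ℝ) : stdNormalCDF z = ∫ t in Iic z, stdNormalPDF t := by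
  rw [stdNormalCDF, cdf_eq_real, measureReal_def, gaussianReal_apply_eq_integral 0 one_ne_zero,
    ENNReal.toReal_ofReal (integral_nonneg fun t => gaussianPDFReal_nonneg 0 1 t)]
  rfl

lemma hasDerivAt_stdNormalCDF (z : ℝ) : HasDerivAt stdNormalCDF (stdNormalPDF z) z := by
  have h : stdNormalCDF = fun z => stdNormalCDF 0 + ∫ t in (0 : ℝ)..z, stdNormalPDF t := by
    funext z
    rw [← intervalIntegral.integral_Iic_sub_Iic integrable_stdNormalPDF.integrableOn
      integrable_stdNormalPDF.integrableOn, ← stdNormalCDF_eq_integral, ← stdNormalCDF_eq_integral]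
    ring
  rw [h]
  exact (intervalIntegral.integral_hasDerivAt_right
    (continuous_stdNormalPDF.intervalIntegrable _ _)
    continuous_stdNormalPDF.stronglyMeasurable.stronglyMeasurableAtFilter
    continuous_stdNormalPDF.continuousAt).const_add _

lemma continuous_stdNormalCDF : Continuous stdNormalCDF :=
  continuous_iff_continuousAt.2 fun z => (hasDerivAt_stdNormalCDF z).continuousAt

lemma strictMono_stdNormalCDF : StrictMono stdNormalCDF :=
  strictMono_of_hasDerivAt_pos hasDerivAt_stdNormalCDF stdNormalPDF_pos

lemma stdNormalCDF_mem_Ioo (z : ℝ) : stdNormalCDF z ∈ Ioo (0 : ℝ) 1 :=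
  ⟨(cdf_nonneg _ (z - 1)).trans_lt (strictMono_stdNormalCDF (sub_one_lt z)),
    (strictMono_stdNormalCDF (lt_add_one z)).trans_le (cdf_le_one _ (z + 1))⟩

lemma range_stdNormalCDF : range stdNormalCDF = Ioo (0 : ℝ) 1 := by
  refine (range_subset_iff.2 stdNormalCDF_mem_Ioo).antisymm fun x hx => ?_
  obtain ⟨a, ha⟩ := ((tendsto_cdf_atBot (gaussianReal 0 1)).eventually_lt_const hx.1).exists
  obtain ⟨b, hb⟩ := ((tendsto_cdf_atTop (gaussianReal 0 1)).eventually_const_lt hx.2).exists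
  exact mem_range_of_exists_le_of_exists_ge continuous_stdNormalCDF ⟨a, ha.le⟩ ⟨b, hb.le⟩

lemma stdNormalQuantile_stdNormalCDF (z : ℝ) : stdNormalQuantile (stdNormalCDF z) = z := by
  simp only [stdNormalQuantile, strictMono_stdNormalCDF.le_iff_le]
  exact csInf_Ici

lemma stdNormalCDF_stdNormalQuantile {x : ℝ} (hx : x ∈ Ioo (0 : ℝ) 1) :
    stdNormalCDF (stdNormalQuantile x) = x := by
  obtain ⟨z, rfl⟩ := range_stdNormalCDF.symm ▸ hx
  rw [stdNormalQuantile_stdNormalCDF]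

lemma stdNormalCDF_le_iff {x : ℝ} (hx : x ∈ Ioo (0 : ℝ) 1) (z : ℝ) :
    stdNormalCDF z ≤ x ↔ z ≤ stdNormalQuantile x := by
  rw [← strictMono_stdNormalCDF.le_iff_le (a := z), stdNormalCDF_stdNormalQuantile hx]

lemma gaussianReal_real_Iio {v s : ℝ} (hs : 0 < s) (hv : s ^ 2 = v) (w : ℝ) :
    (gaussianReal 0 v.toNNReal).real (Iio w) = stdNormalCDF (w / s) := by
  have hmap : (gaussianReal 0 1).map (s * ·) = gaussianReal 0 v.toNNReal := by
    rw [gaussianReal_map_const_mul, mul_zero, mul_one]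
    congr 1
    ext
    simp [← hv, sq_nonneg]
  have : NullSingletonClass (gaussianReal 0 1) := nullSingletonClass_gaussianReal one_ne_zero
  rw [← hmap, map_measureReal_apply (by fun_prop) measurableSet_Iio, stdNormalCDF, cdf_eq_real,
    measureReal_def, measureReal_def]
  congr 1
  have : (s * ·) ⁻¹' Iio w = Iio (w / s) := by
    ext z
    simp [lt_div_iff₀ hs, mul_comm]
  rw [this]
  exact measure_congr Iio_ae_eq_Iic

/-! ### Uniform law of large numbers for empirical distribution functions -/

/-- Monotonicity squeezes the value at `w` between values at rationals on either side, and
continuity of `G` closes the gap. Reducing to countably many levels is what allows a single null set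
for all levels. -/
lemma tendsto_of_monotone_of_tendsto_rat {F : ℕ → ℝ → ℝ} {G : ℝ → ℝ} (hF : ∀ n, Monotone (F n))
    (hG : Continuous G) (h : ∀ q : ℚ, Tendsto (fun n => F n q) atTop (𝓝 (G q))) (w : ℝ) :
    Tendsto (fun n => F n w) atTop (𝓝 (G w)) := by
  refine tendsto_order.2 ⟨fun a ha => ?_, fun a ha => ?_⟩
  · have h1 : ∀ᶠ z in 𝓝[<] w, a < G z :=
      (hG.tendsto w).mono_left nhdsWithin_le_nhds |>.eventually_const_lt ha
    obtain ⟨l, hl, hl'⟩ := (mem_nhdsLT_iff_exists_Ioo_subset).1 h1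
    obtain ⟨q, hq1, hq2⟩ := exists_rat_btwn (show l < w from hl)
    filter_upwards [(h q).eventually_const_lt (hl' ⟨hq1, hq2⟩)] with n hn
    exact hn.trans_le (hF n hq2.le)
  · have h1 : ∀ᶠ z in 𝓝[>] w, G z < a :=
      (hG.tendsto w).mono_left nhdsWithin_le_nhds |>.eventually_lt_const ha
    obtain ⟨u, hu, hu'⟩ := (mem_nhdsGT_iff_exists_Ioo_subset).1 h1
    obtain ⟨q, hq1, hq2⟩ := exists_rat_btwn (show w < u from hu)
    filter_upwards [(h q).eventually_lt_const (hu' ⟨hq1, hq2⟩)] with n hn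
    exact (hF n hq1.le).trans_lt hn

/-- Almost surely, the empirical distribution functions of pairwise independent, identically
distributed random variables converge everywhere to the common one, when that is continuous. -/
lemma ae_forall_tendsto_empirical {Ω : Type*} [MeasurableSpace Ω] {P : Measure Ω}
    [IsProbabilityMeasure P] {W : ℕ → Ω → ℝ} (hW : ∀ i, Measurable (W i))
    (hindep : Pairwise fun i j => IndepFun (W i) (W j) P) {ν : Measure ℝ}
    (hlaw : ∀ i, P.map (W i) = ν) (hν : Continuous fun w => ν.real (Iio w)) :
    ∀ᵐ ω ∂P, ∀ w : ℝ, Tendsto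
      (fun n : ℕ => (1 / n : ℝ) * ∑ i ∈ Finset.range n, (Iio w).indicator (fun _ => 1) (W i ω))
      atTop (𝓝 (ν.real (Iio w))) := by
  have hφ (w : ℝ) : Measurable ((Iio w).indicator fun _ => (1 : ℝ)) :=
    measurable_const.indicator measurableSet_Iio
  have hq : ∀ᵐ ω ∂P, ∀ q : ℚ, Tendsto (fun n : ℕ => (1 / n : ℝ) *
      ∑ i ∈ Finset.range n, (Iio (q : ℝ)).indicator (fun _ => 1) (W i ω)) atTop
      (𝓝 (ν.real (Iio (q : ℝ)))) := by
    refine ae_all_iff.2 fun q => ?_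
    -- The strong law in Etemadi's form needs only pairwise independence.
    have key := strong_law_ae_real (μ := P)
      (fun i ω => (Iio (q : ℝ)).indicator (fun _ => (1 : ℝ)) (W i ω)) ?_ ?_ ?_
    · have hint : ∫ ω, (Iio (q : ℝ)).indicator (fun _ => (1 : ℝ)) (W 0 ω) ∂P
          = ν.real (Iio (q : ℝ)) := by
        rw [← integral_map (hW 0).aemeasurable (hφ q).aestronglyMeasurable, hlaw,
          integral_indicator_const _ measurableSet_Iio]
        simp
      rw [hint] at key
      filter_upwards [key] with ω hω
      simpa only [one_div, inv_mul_eq_div] using hω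
    · refine Integrable.of_bound ((hφ q).comp (hW 0)).aestronglyMeasurable 1 (ae_of_all _ fun ω => ?_)
      simp only [indicator_apply]
      split_ifs <;> simp
    · intro i j hij
      exact (hindep hij).comp (hφ q) (hφ q)
    · intro i
      exact (IdentDistrib.mk (hW i).aemeasurable (hW 0).aemeasurable
        (by rw [hlaw, hlaw])).comp (hφ q)
  filter_upwards [hq] with ω hω w
  refine tendsto_of_monotone_of_tendsto_rat (F := fun (n : ℕ) w => (1 / n : ℝ) *
    ∑ i ∈ Finset.range n, (Iio w).indicator (fun _ => 1) (W i ω)) (fun n a b hab => ?_) hν hω w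
  refine mul_le_mul_of_nonneg_left (Finset.sum_le_sum fun i _ => ?_) (by positivity)
  exact indicator_le_indicator_of_subset (Iio_subset_Iio hab) (fun _ => zero_le_one) _

/-! ### Independence of the driving factors -/

section Model

variable {Ω : Type*}

lemma Factors.measurable_Y_sigma (F : Factors Ω) (t : ℝ≥0) :
    Measurable[F.sigma .aggregate] (F.Y t) :=
  (measurable_pi_apply t).comp (comap_measurable fun ω t => F.Y t ω)

lemma Factors.measurable_X_sigma (F : Factors Ω) (i : ℕ) (t : ℝ≥0) :
    Measurable[F.sigma (.asset i)] (F.X i t) :=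
  (measurable_pi_apply t).comp (comap_measurable fun ω t => F.X i t ω)

lemma Factors.measurable_Z_sigma (F : Factors Ω) (i : ℕ) (t : ℝ≥0) :
    Measurable[F.sigma (.liability i)] (F.Z i t) :=
  (measurable_pi_apply t).comp (comap_measurable fun ω t => F.Z i t ω)

lemma Factors.measurable_N_sigma (F : Factors Ω) (t : ℝ≥0) :
    Measurable[F.sigma .count] (F.N t) :=
  (measurable_pi_apply t).comp (comap_measurable fun ω t => F.N t ω)

lemma Factors.measurable_ξ_sigma (F : Factors Ω) (j : ℕ) :
    Measurable[F.sigma (.jump j)] (F.ξ j) :=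
  comap_measurable (F.ξ j)

/-- The σ-algebra generated by a set of driving factors. -/
@[reducible] def Factors.jointSigma (F : Factors Ω) (S : Set FactorIndex) : MeasurableSpace Ω :=
  ⨆ i ∈ S, F.sigma i

lemma Factors.sigma_le_jointSigma (F : Factors Ω) {S : Set FactorIndex} {i : FactorIndex}
    (hi : i ∈ S) : F.sigma i ≤ F.jointSigma S :=
  le_iSup₂ (f := fun i (_ : i ∈ S) => F.sigma i) i hi

lemma Factors.measurable_jumpSum_jointSigma (F : Factors Ω) {S : Set FactorIndex} {k : ℕ}
    (hS : ∀ j < k, .jump j ∈ S) : Measurable[F.jointSigma S] (jumpSum F k) := by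
  refine @Finset.measurable_fun_sum ℝ ℕ Ω _ _ _ (F.jointSigma S) _ _ fun j hj => ?_
  exact (F.measurable_ξ_sigma j).mono
    (F.sigma_le_jointSigma (hS j (Finset.mem_range.1 hj))) le_rfl

/-- The index set is countable, so measurability in `ω` for each fixed index gives joint
measurability. The σ-algebra is arbitrary so that the lemma applies to `jointSigma`. -/
lemma measurable_eval_natCast_index {m : MeasurableSpace Ω} {S : ℕ → Ω → ℝ} {N : Ω → ℕ}
    (hS : ∀ k, Measurable (S k)) (hN : Measurable N) : Measurable fun ω => S (N ω) ω :=
  (measurable_from_prod_countable_right (f := fun q : ℕ × Ω => S q.1 q.2) hS).comp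
    (hN.prodMk measurable_id)

/-- The complement of the aggregate label is all that is needed to make the compound Poisson process
independent of `Y`. -/
lemma Factors.measurable_compoundPoisson_jointSigma (F : Factors Ω) (t : ℝ≥0) :
    Measurable[F.jointSigma {.aggregate}ᶜ] (compoundPoisson F t) :=
  measurable_eval_natCast_index
    (fun k => F.measurable_jumpSum_jointSigma fun j _ => by simp)
    ((F.measurable_N_sigma t).mono (F.sigma_le_jointSigma (by simp)) le_rfl)

lemma measurable_const_mul_add_const_mul {m : MeasurableSpace Ω} {X Z : Ω → ℝ} (hX : Measurable X)
    (hZ : Measurable Z) (a b : ℝ) : Measurable fun ω => a * X ω + b * Z ω := by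
  fun_prop

lemma jumpSum_succ (F : Factors Ω) (k : ℕ) : jumpSum F (k + 1) = jumpSum F k + F.ξ k := by
  funext ω
  exact Finset.sum_range_succ _ _

/-- The idiosyncratic part of the logarithm of the ratio of assets to liabilities at maturity. -/
def idioNoise (p : Params) (F : Factors Ω) (i : ℕ) (ω : Ω) : ℝ :=
  p.σ * √(1 - p.ρ) * F.X i p.T ω + -(p.β * √(1 - p.θ)) * F.Z i p.T ω

lemma Factors.measurable_idioNoise_jointSigma (F : Factors Ω) (p : Params) (i : ℕ) :
    Measurable[F.jointSigma {.asset i, .liability i}] (idioNoise p F i) := by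
  have hX := (F.measurable_X_sigma i p.T).mono
    (F.sigma_le_jointSigma (S := {.asset i, .liability i}) (by simp)) le_rfl
  have hZ := (F.measurable_Z_sigma i p.T).mono
    (F.sigma_le_jointSigma (S := {.asset i, .liability i}) (by simp)) le_rfl
  exact measurable_const_mul_add_const_mul hX hZ _ _

variable [MeasurableSpace Ω] {P : Measure Ω} {F : Factors Ω} {r : ℝ≥0}

lemma IsFactorModel.sigma_le (hF : IsFactorModel F r P) (i : FactorIndex) :
    F.sigma i ≤ ‹MeasurableSpace Ω› := by
  cases i with
  | aggregate => exact (measurable_pi_lambda _ fun t => hF.measurable_Y t).comap_le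
  | asset i => exact (measurable_pi_lambda _ fun t => hF.measurable_X i t).comap_le
  | liability i => exact (measurable_pi_lambda _ fun t => hF.measurable_Z i t).comap_le
  | count => exact (measurable_pi_lambda _ fun t => hF.poisson_N.measurable t).comap_le
  | jump j => exact (hF.measurable_ξ j).comap_le

lemma IsFactorModel.jointSigma_le (hF : IsFactorModel F r P) (S : Set FactorIndex) :
    F.jointSigma S ≤ ‹MeasurableSpace Ω› :=
  iSup₂_le fun i _ => hF.sigma_le i

/-- Disjoint groups of independent σ-algebras generate independent σ-algebras. Every independence
claim about the model is an instance of this, with suitable sets of labels. -/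
lemma IsFactorModel.indepFun (hF : IsFactorModel F r P) {S S' : Set FactorIndex}
    (hS : Disjoint S S') {α β : Type*} [MeasurableSpace α] [MeasurableSpace β] {f : Ω → α}
    {g : Ω → β} (hf : Measurable[F.jointSigma S] f) (hg : Measurable[F.jointSigma S'] g) :
    IndepFun f g P :=
  (IndepFun_iff_Indep _ _ _).2 (indep_of_indep_of_le
    (indep_iSup_of_disjoint hF.sigma_le hF.indep hS) hf.comap_le hg.comap_le)

lemma IsFactorModel.measurable_jumpSum (hF : IsFactorModel F r P) (k : ℕ) :
    Measurable (jumpSum F k) :=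
  (F.measurable_jumpSum_jointSigma (S := univ) fun _ _ => mem_univ _).mono
    (hF.jointSigma_le _) le_rfl

lemma IsFactorModel.measurable_compoundPoisson (hF : IsFactorModel F r P) (t : ℝ≥0) :
    Measurable (compoundPoisson F t) :=
  (F.measurable_compoundPoisson_jointSigma t).mono (hF.jointSigma_le _) le_rfl

/-! ### The laws of the jump sums and of the compound Poisson process -/

lemma jumpSumLaw_zero [IsProbabilityMeasure P] (F : Factors Ω) :
    jumpSumLaw F P 0 = Measure.dirac 0 := by
  have : jumpSum F 0 = fun _ => 0 := by
    funext ω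
    simp [jumpSum]
  rw [jumpSumLaw, this, Measure.map_const, measure_univ, one_smul]

lemma IsFactorModel.jumpSumLaw_succ [IsProbabilityMeasure P] (hF : IsFactorModel F r P) (k : ℕ) :
    jumpSumLaw F P (k + 1) = Measure.conv (jumpSumLaw F P k) (P.map (F.ξ 0)) := by
  have hind : IndepFun (jumpSum F k) (F.ξ k) P := by
    refine hF.indepFun (S := FactorIndex.jump '' Iio k) (S' := {.jump k}) (by simp)
      (F.measurable_jumpSum_jointSigma fun j hj => ⟨j, hj, rfl⟩)
      ((F.measurable_ξ_sigma k).mono (F.sigma_le_jointSigma (by simp)) le_rfl)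
  rw [jumpSumLaw, jumpSum_succ, hind.map_add_eq_map_conv_map (hF.measurable_jumpSum k)
    (hF.measurable_ξ k), (hF.identDistrib_ξ k).map_eq]
  rfl

lemma IsFactorModel.jumpSumLaw_eq_convPow [IsProbabilityMeasure P] (hF : IsFactorModel F r P)
    (k : ℕ) : jumpSumLaw F P k = convPow (P.map (F.ξ 0)) k := by
  induction k with
  | zero => exact jumpSumLaw_zero F
  | succ k ih => rw [hF.jumpSumLaw_succ, ih, convPow]

lemma measurable_densityConvPow {g : ℝ → ℝ≥0∞} (hg : Measurable g) (k : ℕ) :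
    Measurable (densityConvPow g k) := by
  induction k with
  | zero => exact hg
  | succ k ih => exact measurable_lconvolution volume ih hg

lemma IsFactorModel.jumpSumLaw_eq_withDensity [IsProbabilityMeasure P] (hF : IsFactorModel F r P)
    {g : ℝ → ℝ≥0∞} (hg : Measurable g) (h : P.map (F.ξ 0) = volume.withDensity g) (k : ℕ) :
    jumpSumLaw F P (k + 1) = volume.withDensity (densityConvPow g k) := by
  induction k with
  | zero =>
    rw [hF.jumpSumLaw_succ, jumpSumLaw_zero, Measure.dirac_zero_conv, h, densityConvPow]
  | succ k ih =>
    rw [hF.jumpSumLaw_succ, ih, h,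
      conv_withDensity_eq_lconvolution (measurable_densityConvPow hg k) hg, densityConvPow]

lemma IsFactorModel.jumpSumLaw_ae_nonneg (hF : IsFactorModel F r P) (k : ℕ) :
    ∀ᵐ u ∂(jumpSumLaw F P k), u ∈ Ici (0 : ℝ) := by
  refine (ae_map_iff (hF.measurable_jumpSum k).aemeasurable measurableSet_Ici).2 ?_
  filter_upwards [ae_all_iff.2 hF.nonneg_ξ] with ω hω
  exact Finset.sum_nonneg fun j _ => hω j

lemma IsFactorModel.measure_count_eq {p : Params} (hF : IsFactorModel F p.lam P) (k : ℕ) :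
    P (F.N p.T ⁻¹' {k}) = ENNReal.ofReal (p.poissonWeight k) := by
  -- Only increments have a prescribed law, and the start at 0 holds only almost surely; so the
  -- count is replaced by its increment from time 0 up to a null set.
  have hlaw := hF.poisson_N.lawIncrements 0 p.T zero_le
  have h : P (F.N p.T ⁻¹' {k}) = P ((fun ω => F.N p.T ω - F.N 0 ω) ⁻¹' {k}) := by
    refine measure_congr (eventuallyEq_set.2 ?_)
    filter_upwards [hF.poisson_N.start] with ω hω
    simp only [mem_preimage, hω, tsub_zero]
  rw [h, ← Measure.map_apply_of_aemeasurable hlaw.aemeasurable (measurableSet_singleton k),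
    hlaw.map_eq, poissonMeasure_singleton, Params.poissonWeight]
  simp

lemma Params.poissonWeight_nonneg (p : Params) (k : ℕ) : 0 ≤ p.poissonWeight k := by
  unfold Params.poissonWeight
  positivity

/-- Split Ω by the value of the count; on each piece the compound sum is a fixed `jumpSum`,
independent of the count. -/
lemma IsFactorModel.map_compoundPoisson {p : Params} (hF : IsFactorModel F p.lam P) :
    P.map (compoundPoisson F p.T) =
      Measure.sum fun k => ENNReal.ofReal (p.poissonWeight k) • jumpSumLaw F P k := by
  ext s hs
  rw [Measure.map_apply (hF.measurable_compoundPoisson _) hs, Measure.sum_apply _ hs]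
  have hU : compoundPoisson F p.T ⁻¹' s = ⋃ k, F.N p.T ⁻¹' {k} ∩ jumpSum F k ⁻¹' s := by
    ext ω
    simp [compoundPoisson]
  rw [hU, measure_iUnion]
  · congr with k
    have hind : IndepFun (F.N p.T) (jumpSum F k) P := by
      refine hF.indepFun (S := {.count}) (S' := range FactorIndex.jump) (by simp)
        ((F.measurable_N_sigma _).mono (F.sigma_le_jointSigma (by simp)) le_rfl)
        (F.measurable_jumpSum_jointSigma fun j _ => mem_range_self j)
    rw [hind.measure_inter_preimage_eq_mul _ _ (measurableSet_singleton k) hs,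
      hF.measure_count_eq, Measure.smul_apply, smul_eq_mul, jumpSumLaw,
      Measure.map_apply (hF.measurable_jumpSum k) hs]
  · intro i j hij
    exact (Disjoint.preimage _ (by simpa using hij)).mono inter_subset_left inter_subset_left
  · exact fun k => (hF.poisson_N.measurable _ (measurableSet_singleton k)).inter
      (hF.measurable_jumpSum k hs)

lemma IsFactorModel.map_compoundPoisson_eq_add_jumpMixture [IsProbabilityMeasure P] {p : Params}
    (hF : IsFactorModel F p.lam P) :
    P.map (compoundPoisson F p.T) =
      ENNReal.ofReal (p.poissonWeight 0) • Measure.dirac 0 + jumpMixture p F P := by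
  rw [hF.map_compoundPoisson, jumpMixture, ← jumpSumLaw_zero (P := P) F]
  ext s hs
  rw [Measure.add_apply, Measure.sum_apply _ hs, Measure.sum_apply _ hs,
    tsum_eq_zero_add' ENNReal.summable]

lemma IsFactorModel.jumpMixture_ae_nonneg {p : Params} (hF : IsFactorModel F r P) :
    ∀ᵐ u ∂(jumpMixture p F P), u ∈ Ici (0 : ℝ) :=
  (Measure.ae_sum_iff' measurableSet_Ici).2 fun k =>
    Measure.ae_smul_measure (hF.jumpSumLaw_ae_nonneg (k + 1)) _

lemma IsFactorModel.hasSum_integral_jumpSumLaw {p : Params} (hF : IsFactorModel F p.lam P)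
    {f : ℝ → ℝ} (hf : Integrable f (P.map (compoundPoisson F p.T))) :
    HasSum (fun k => p.poissonWeight k * ∫ u in Ici (0 : ℝ), f u ∂(jumpSumLaw F P k))
      (∫ u, f u ∂(P.map (compoundPoisson F p.T))) := by
  rw [hF.map_compoundPoisson] at hf ⊢
  convert! hasSum_integral_measure hf using 2 with k
  -- Restricting to the half-line changes nothing, since jump sums are almost surely nonnegative.
  rw [integral_smul_measure, ENNReal.toReal_ofReal (p.poissonWeight_nonneg k), smul_eq_mul,
    Measure.restrict_eq_self_of_ae_mem (hF.jumpSumLaw_ae_nonneg k)]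

/-- Integrals with respect to the law of the compound Poisson process as series over the number of
jumps. -/
lemma IsFactorModel.integral_map_compoundPoisson [IsProbabilityMeasure P] {p : Params}
    (hF : IsFactorModel F p.lam P) {f : ℝ → ℝ}
    (hf : Integrable f (P.map (compoundPoisson F p.T))) :
    Summable (fun k => p.poissonWeight (k + 1) *
      ∫ u in Ici (0 : ℝ), f u ∂(jumpSumLaw F P (k + 1))) ∧
    ∫ u, f u ∂(P.map (compoundPoisson F p.T)) = p.poissonWeight 0 * f 0 +
      ∑' k, p.poissonWeight (k + 1) * ∫ u in Ici (0 : ℝ), f u ∂(jumpSumLaw F P (k + 1)) := by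
  have h := hF.hasSum_integral_jumpSumLaw hf
  refine ⟨(summable_nat_add_iff 1).2 h.summable, ?_⟩
  rw [← h.tsum_eq, h.summable.tsum_eq_zero_add,
    Measure.restrict_eq_self_of_ae_mem (hF.jumpSumLaw_ae_nonneg 0), jumpSumLaw_zero, integral_dirac]

/-! ### Convergence of the portfolio loss -/

/-- The level that the idiosyncratic noise of a loan must stay below in the case of default. -/
def defaultLevel (p : Params) (F : Factors Ω) (P : Measure Ω) (ω : Ω) : ℝ :=
  p.threshold - compensator p F P * p.T - p.aggVol * F.Y p.T ω + compoundPoisson F p.T ω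

lemma loss_eq_indicator (p : Params) (F : Factors Ω) (P : Measure Ω) (i : ℕ) (ω : Ω) :
    loss p F P i ω =
      (Iio (defaultLevel p F P ω)).indicator (fun _ => 1) (idioNoise p F i ω) := by
  have hA := p.A₀_pos
  have hB := p.B₀_pos
  have hiff : asset p F P i p.T ω / liability p F i p.T ω ∈ Ioo (0 : ℝ) 1 ↔
      idioNoise p F i ω ∈ Iio (defaultLevel p F P ω) := by
    have hA' : 0 < asset p F P i p.T ω := mul_pos hA (Real.exp_pos _)
    have hB' : 0 < liability p F i p.T ω := mul_pos hB (Real.exp_pos _)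
    -- After taking logarithms, both inequalities are put in the form of a positive difference, so
    -- that `ring_nf` can identify them.
    rw [mem_Ioo, and_iff_right (div_pos hA' hB'), div_lt_one hB', ← Real.log_lt_log_iff hA' hB',
      asset, liability, Real.log_mul hA.ne' (Real.exp_ne_zero _), Real.log_exp,
      Real.log_mul hB.ne' (Real.exp_ne_zero _), Real.log_exp, mem_Iio, idioNoise, defaultLevel,
      Params.threshold, Params.aggVol, Real.log_div hB.ne' hA.ne', ← sub_pos,
      ← sub_pos (b := _ + -_ * _)]
    ring_nf
  simp only [loss, indicator_apply, hiff]

lemma IsFactorModel.measurable_idioNoise (hF : IsFactorModel F r P) (p : Params) (i : ℕ) :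
    Measurable (idioNoise p F i) :=
  ((hF.measurable_X i _).const_mul _).add ((hF.measurable_Z i _).const_mul _)

lemma IsFactorModel.pairwise_indepFun_idioNoise (hF : IsFactorModel F r P) (p : Params) :
    Pairwise fun i j => IndepFun (idioNoise p F i) (idioNoise p F j) P := by
  intro i j hij
  exact hF.indepFun (by simp [hij.symm]) (F.measurable_idioNoise_jointSigma p i)
    (F.measurable_idioNoise_jointSigma p j)

lemma Params.idioVol_sq (p : Params) :
    p.idioVol ^ 2 = p.σ ^ 2 * (1 - p.ρ) + p.β ^ 2 * (1 - p.θ) := by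
  have hρ := sub_nonneg.2 p.ρ_mem.2
  have hθ := sub_nonneg.2 p.θ_mem.2
  exact Real.sq_sqrt (by positivity)

lemma map_const_mul_of_hasLaw_gaussianReal {Y : Ω → ℝ} {v : ℝ≥0}
    (hY : HasLaw Y (gaussianReal 0 v) P) (c : ℝ) :
    P.map (fun ω => c * Y ω) = gaussianReal 0 (c ^ 2 * v).toNNReal := by
  rw [(gaussianReal_const_mul hY c).map_eq, mul_zero]
  congr 1
  ext
  rw [Real.coe_toNNReal _ (by positivity)]
  rfl

lemma IsFactorModel.map_idioNoise (hF : IsFactorModel F r P) (p : Params) (i : ℕ) :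
    P.map (idioNoise p F i) = gaussianReal 0 (p.idioVol ^ 2 * p.T).toNNReal := by
  have hind : IndepFun (F.X i p.T) (F.Z i p.T) P :=
    hF.indepFun (S := {.asset i}) (S' := {.liability i}) (by simp)
      ((F.measurable_X_sigma i _).mono (F.sigma_le_jointSigma (by simp)) le_rfl)
      ((F.measurable_Z_sigma i _).mono (F.sigma_le_jointSigma (by simp)) le_rfl)
  have key := gaussianReal_add_gaussianReal_of_indepFun
    (hind.comp (φ := fun x => p.σ * √(1 - p.ρ) * x) (ψ := fun z => -(p.β * √(1 - p.θ)) * z)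
      (by fun_prop) (by fun_prop))
    (map_const_mul_of_hasLaw_gaussianReal ((hF.brownian_X i).hasLaw_eval p.T) _)
    (map_const_mul_of_hasLaw_gaussianReal ((hF.brownian_Z i).hasLaw_eval p.T) _)
  refine key.trans ?_
  rw [add_zero, ← Real.toNNReal_add (by positivity) (by positivity), p.idioVol_sq, mul_pow, neg_sq,
    mul_pow, Real.sq_sqrt (sub_nonneg.2 p.ρ_mem.2), Real.sq_sqrt (sub_nonneg.2 p.θ_mem.2), add_mul]

lemma IsFactorModel.ae_tendsto_portfolioLoss [IsProbabilityMeasure P] {p : Params}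
    (hF : IsFactorModel F r P) (hζ : 0 < p.idioVol) :
    ∀ᵐ ω ∂P, Tendsto (fun n => portfolioLoss p F P n ω) atTop
      (𝓝 (stdNormalCDF (defaultLevel p F P ω / (p.idioVol * √(p.T : ℝ))))) := by
  have hT : (0 : ℝ) < p.T := p.T_pos
  have hreal (w : ℝ) := gaussianReal_real_Iio (v := p.idioVol ^ 2 * p.T)
    (s := p.idioVol * √(p.T : ℝ)) (by positivity) (by rw [mul_pow, Real.sq_sqrt hT.le]) w
  have h := ae_forall_tendsto_empirical (hF.measurable_idioNoise p)
    (hF.pairwise_indepFun_idioNoise p) (hF.map_idioNoise p) (by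
      simp only [hreal]
      exact continuous_stdNormalCDF.comp (continuous_id.div_const _))
  filter_upwards [h] with ω hω
  -- The level may depend on `ω` because the exceptional null set does not depend on the level.
  simpa only [hreal, portfolioLoss, loss_eq_indicator] using hω (defaultLevel p F P ω)

lemma IsFactorModel.limitingLoss_ae_eq [IsProbabilityMeasure P] {p : Params}
    (hF : IsFactorModel F r P) (hζ : 0 < p.idioVol) :
    limitingLoss p F P =ᵐ[P]
      fun ω => stdNormalCDF (defaultLevel p F P ω / (p.idioVol * √(p.T : ℝ))) := by
  filter_upwards [hF.ae_tendsto_portfolioLoss hζ] with ω hω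
  exact hω.limUnder_eq

/-! ### The distribution of the limiting loss -/

/-- The variance Σ² splits as ζ² + Λ². Thus ζ > 0 forces Σ > 0, and Σ = ζ when Λ = 0. -/
lemma Params.totalVol_eq (p : Params) : p.totalVol = √(p.idioVol ^ 2 + p.aggVol ^ 2) := by
  rw [Params.totalVol, p.idioVol_sq, Params.aggVol, Real.sqrt_mul p.ρ_mem.1, sub_sq, mul_pow, mul_pow,
    Real.sq_sqrt p.ρ_mem.1, Real.sq_sqrt p.θ_mem.1]
  ring_nf

lemma Params.totalVol_pos {p : Params} (hζ : 0 < p.idioVol) : 0 < p.totalVol := by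
  rw [p.totalVol_eq]
  positivity

lemma Params.totalVol_eq_idioVol {p : Params} (h : p.aggVol = 0) : p.totalVol = p.idioVol := by
  rw [p.totalVol_eq, h, zero_pow two_ne_zero, add_zero]
  exact Real.sqrt_sq (Real.sqrt_nonneg _)

lemma Params.sqrt_T_pos (p : Params) : 0 < √(p.T : ℝ) :=
  Real.sqrt_pos.2 (NNReal.coe_pos.2 p.T_pos)

lemma totalVol_mul_stdNormalQuantile_noJumpProb {p : Params} (hζ : 0 < p.idioVol) :
    p.totalVol * stdNormalQuantile (noJumpProb p F P) =
      (p.threshold - compensator p F P * p.T) / √(p.T : ℝ) := by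
  have h1 := p.totalVol_pos hζ
  have h2 := p.sqrt_T_pos
  rw [noJumpProb, stdNormalQuantile_stdNormalCDF]
  field_simp

lemma IsFactorModel.limitingLoss_ae_mem_Ioo [IsProbabilityMeasure P] {p : Params}
    (hF : IsFactorModel F r P) (hζ : 0 < p.idioVol) :
    ∀ᵐ ω ∂P, limitingLoss p F P ω ∈ Ioo (0 : ℝ) 1 := by
  filter_upwards [hF.limitingLoss_ae_eq hζ] with ω hω
  rw [hω]
  exact stdNormalCDF_mem_Ioo _

lemma IsFactorModel.real_limitingLoss_le [IsProbabilityMeasure P] {p : Params}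
    (hF : IsFactorModel F r P) (hζ : 0 < p.idioVol) {x : ℝ} (hx : x ∈ Ioo (0 : ℝ) 1) :
    P.real {ω | limitingLoss p F P ω ≤ x} =
      P.real {ω | defaultLevel p F P ω / (p.idioVol * √(p.T : ℝ)) ≤ stdNormalQuantile x} := by
  refine measureReal_congr (eventuallyEq_set.2 ?_)
  filter_upwards [hF.limitingLoss_ae_eq hζ] with ω hω
  rw [hω, stdNormalCDF_le_iff hx]

lemma noJumpProb_le_iff {p : Params} (hζ : 0 < p.idioVol) {x : ℝ} (hx : x ∈ Ioo (0 : ℝ) 1) :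
    noJumpProb p F P ≤ x ↔ 0 ≤ jumpBound p F P x := by
  have h := mul_pos (p.totalVol_pos hζ) p.sqrt_T_pos
  rw [jumpBound, mul_nonneg_iff_of_pos_left h, sub_nonneg, noJumpProb,
    stdNormalQuantile_stdNormalCDF, stdNormalCDF_le_iff hx]

lemma IsFactorModel.limitingLoss_distribution_of_aggVol_eq_zero [IsProbabilityMeasure P]
    {p : Params} (hF : IsFactorModel F p.lam P) (hζ : 0 < p.idioVol) (hΛ : p.aggVol = 0) {x : ℝ}
    (hx : x ∈ Ioo (0 : ℝ) 1) :
    Summable (fun k : ℕ => p.poissonWeight (k + 1) *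
        (jumpSumLaw F P (k + 1)).real (Icc 0 (jumpBound p F P x))) ∧
      P.real {ω | limitingLoss p F P ω ≤ x} =
        p.poissonWeight 0 * (Icc (noJumpProb p F P) 1).indicator (fun _ => (1 : ℝ)) x
          + ∑' k : ℕ, p.poissonWeight (k + 1) *
            (jumpSumLaw F P (k + 1)).real (Icc 0 (jumpBound p F P x)) := by
  set M := jumpBound p F P x with hM
  have hset : {ω | defaultLevel p F P ω / (p.idioVol * √(p.T : ℝ)) ≤ stdNormalQuantile x} =
      compoundPoisson F p.T ⁻¹' Iic M := by
    ext ω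
    have hT := p.sqrt_T_pos
    have hq := totalVol_mul_stdNormalQuantile_noJumpProb (P := P) (F := F) hζ
    rw [eq_div_iff hT.ne'] at hq
    have hMq : M = p.idioVol * √(p.T : ℝ) * stdNormalQuantile x -
        (p.threshold - compensator p F P * p.T) := by
      rw [hM, jumpBound, ← hq, p.totalVol_eq_idioVol hΛ]
      ring
    rw [mem_ofPred_eq, div_le_iff₀ (by positivity), mem_preimage, mem_Iic, hMq, defaultLevel, hΛ,
      ← sub_nonneg, ← sub_nonneg (b := compoundPoisson F p.T ω)]
    ring_nf
  have hIic (k : ℕ) : ∫ u in Ici (0 : ℝ), (Iic M).indicator (fun _ => (1 : ℝ)) u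
      ∂(jumpSumLaw F P k) = (jumpSumLaw F P k).real (Icc 0 M) := by
    rw [integral_indicator_const _ measurableSet_Iic, measureReal_restrict_apply measurableSet_Iic,
      inter_comm, Ici_inter_Iic, smul_eq_mul, mul_one]
  obtain ⟨h1, h2⟩ := hF.integral_map_compoundPoisson (f := (Iic M).indicator fun _ => (1 : ℝ))
    ((integrable_const 1).indicator measurableSet_Iic)
  simp only [hIic] at h1 h2
  refine ⟨h1, ?_⟩
  rw [hF.real_limitingLoss_le hζ hx, hset,
    ← map_measureReal_apply (hF.measurable_compoundPoisson _) measurableSet_Iic]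
  rw [integral_indicator_const _ measurableSet_Iic, smul_eq_mul, mul_one] at h2
  rw [h2]
  congr 2
  -- The atom at zero jumps contributes exactly when 0 ≤ M, which is the condition p̃ ≤ x; the bound
  -- x ≤ 1 is automatic.
  simp only [indicator_apply, mem_Iic, mem_Icc, noJumpProb_le_iff hζ hx, hx.2.le, and_true, hM]

/-- The aggregate factor at maturity, scaled to a standard normal random variable. -/
def normalizedFactor (p : Params) (F : Factors Ω) (ω : Ω) : ℝ :=
  -(p.aggVol / (|p.aggVol| * √(p.T : ℝ))) * F.Y p.T ω

lemma IsFactorModel.measurable_normalizedFactor (hF : IsFactorModel F r P) (p : Params) :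
    Measurable (normalizedFactor p F) :=
  (hF.measurable_Y _).const_mul _

/-- The quotient Λ / |Λ| is a sign and squares to 1, so the variance is T / T = 1. -/
lemma IsFactorModel.map_normalizedFactor (hF : IsFactorModel F r P) {p : Params}
    (hΛ : p.aggVol ≠ 0) : P.map (normalizedFactor p F) = gaussianReal 0 1 := by
  have hT : (0 : ℝ) < p.T := p.T_pos
  have h := map_const_mul_of_hasLaw_gaussianReal (hF.brownian_Y.hasLaw_eval p.T)
    (-(p.aggVol / (|p.aggVol| * √(p.T : ℝ))))
  refine h.trans ?_
  congr 1
  rw [neg_sq, div_pow, mul_pow, sq_abs, Real.sq_sqrt hT.le]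
  have : p.aggVol ^ 2 / (p.aggVol ^ 2 * (p.T : ℝ)) * p.T = 1 := by field_simp
  rw [this, Real.toNNReal_one]

lemma IsFactorModel.map_compoundPoisson_prodMk_normalizedFactor [IsProbabilityMeasure P]
    (hF : IsFactorModel F r P) {p : Params} (hΛ : p.aggVol ≠ 0) :
    P.map (fun ω => (compoundPoisson F p.T ω, normalizedFactor p F ω)) =
      (P.map (compoundPoisson F p.T)).prod (gaussianReal 0 1) := by
  have hY : Measurable[F.jointSigma {.aggregate}] (normalizedFactor p F) :=
    (measurable_const_mul _).comp
      ((F.measurable_Y_sigma _).mono (F.sigma_le_jointSigma rfl) le_rfl)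
  have hind : IndepFun (compoundPoisson F p.T) (normalizedFactor p F) P :=
    hF.indepFun disjoint_compl_left
      (F.measurable_compoundPoisson_jointSigma _) hY
  have h := hind.map_prod_eq_prod_map_map (hF.measurable_compoundPoisson _).aemeasurable
    (hF.measurable_normalizedFactor p).aemeasurable
  rwa [hF.map_normalizedFactor hΛ] at h

/-- The probability of an event that concerns the two systematic risks. -/
lemma IsFactorModel.measure_systematic [IsProbabilityMeasure P] (hF : IsFactorModel F r P)
    {p : Params} (hΛ : p.aggVol ≠ 0) {A : Set (ℝ × ℝ)} (hA : MeasurableSet A) :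
    P {ω | (compoundPoisson F p.T ω, normalizedFactor p F ω) ∈ A} =
      ∫⁻ u, gaussianReal 0 1 (Prod.mk u ⁻¹' A) ∂(P.map (compoundPoisson F p.T)) := by
  rw [← Measure.prod_apply hA, ← hF.map_compoundPoisson_prodMk_normalizedFactor hΛ,
    Measure.map_apply
      ((hF.measurable_compoundPoisson _).prodMk (hF.measurable_normalizedFactor p)) hA]
  rfl

/-- The sign built into `normalizedFactor` makes its coefficient |Λ| / ζ positive whatever the sign
of Λ, so solving for the factor preserves inequalities. -/
lemma defaultLevel_div_eq {p : Params} (hζ : 0 < p.idioVol) (hΛ : p.aggVol ≠ 0) (ω : Ω) :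
    defaultLevel p F P ω / (p.idioVol * √(p.T : ℝ)) =
      (p.totalVol * stdNormalQuantile (noJumpProb p F P) + compoundPoisson F p.T ω / √(p.T : ℝ))
        / p.idioVol + |p.aggVol| / p.idioVol * normalizedFactor p F ω := by
  have hT := p.sqrt_T_pos
  have hΛ' := abs_pos.2 hΛ
  rw [totalVol_mul_stdNormalQuantile_noJumpProb hζ, defaultLevel, normalizedFactor]
  field_simp
  ring

lemma continuous_H (p : Params) (F : Factors Ω) (P : Measure Ω) (x : ℝ) :
    Continuous (H p F P x) := by
  unfold H
  fun_prop

lemma le_stdNormalQuantile_iff_le_H {p : Params} (hζ : 0 < p.idioVol) (hΛ : p.aggVol ≠ 0)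
    (x u g : ℝ) :
    (p.totalVol * stdNormalQuantile (noJumpProb p F P) + u / √(p.T : ℝ)) / p.idioVol
      + |p.aggVol| / p.idioVol * g ≤ stdNormalQuantile x ↔ g ≤ H p F P x u := by
  have hΛ' := abs_pos.2 hΛ
  rw [H, one_div, inv_mul_eq_div, le_div_iff₀ hΛ', div_mul_eq_mul_div, ← add_div, div_le_iff₀ hζ,
    ← sub_nonneg, ← sub_nonneg (b := g * _)]
  ring_nf

lemma IsFactorModel.limitingLoss_distribution_of_aggVol_ne_zero [IsProbabilityMeasure P]
    {p : Params} (hF : IsFactorModel F p.lam P) (hζ : 0 < p.idioVol) (hΛ : p.aggVol ≠ 0) {x : ℝ}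
    (hx : x ∈ Ioo (0 : ℝ) 1) :
    Summable (fun k : ℕ => p.poissonWeight (k + 1) *
        ∫ u in Ici (0 : ℝ), stdNormalCDF (H p F P x u) ∂(jumpSumLaw F P (k + 1))) ∧
      P.real {ω | limitingLoss p F P ω ≤ x} =
        p.poissonWeight 0 * stdNormalCDF (H p F P x 0) + ∑' k : ℕ, p.poissonWeight (k + 1) *
          ∫ u in Ici (0 : ℝ), stdNormalCDF (H p F P x u) ∂(jumpSumLaw F P (k + 1)) := by
  have hcont : Continuous fun u => stdNormalCDF (H p F P x u) :=
    continuous_stdNormalCDF.comp (continuous_H p F P x)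
  have hint : Integrable (fun u => stdNormalCDF (H p F P x u))
      (P.map (compoundPoisson F p.T)) := by
    refine Integrable.of_bound hcont.aestronglyMeasurable 1 (ae_of_all _ fun u => ?_)
    rw [Real.norm_of_nonneg (stdNormalCDF_mem_Ioo _).1.le]
    exact (stdNormalCDF_mem_Ioo _).2.le
  obtain ⟨h1, h2⟩ := hF.integral_map_compoundPoisson hint
  refine ⟨h1, ?_⟩
  have hset : {ω | defaultLevel p F P ω / (p.idioVol * √(p.T : ℝ)) ≤ stdNormalQuantile x} =
      {ω | (compoundPoisson F p.T ω, normalizedFactor p F ω) ∈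
        {q : ℝ × ℝ | q.2 ≤ H p F P x q.1}} := by
    ext ω
    rw [mem_ofPred_eq, mem_ofPred_eq, defaultLevel_div_eq hζ hΛ, le_stdNormalQuantile_iff_le_H hζ hΛ,
      mem_ofPred_eq]
  have hA : MeasurableSet {q : ℝ × ℝ | q.2 ≤ H p F P x q.1} :=
    measurableSet_le measurable_snd ((continuous_H p F P x).measurable.comp measurable_fst)
  rw [← h2, hF.real_limitingLoss_le hζ hx, hset, measureReal_def, hF.measure_systematic hΛ hA,
    integral_eq_lintegral_of_nonneg_ae (ae_of_all _ fun u => (stdNormalCDF_mem_Ioo _).1.le)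
      hcont.aestronglyMeasurable]
  congr 1
  refine lintegral_congr fun u => ?_
  rw [stdNormalCDF, ofReal_cdf]
  rfl

/-! ### The density of the limiting loss -/

lemma gaussianReal_preimage_affine (m : ℝ) {c : ℝ} (hc : 0 < c) {t : Set ℝ}
    (ht : MeasurableSet t) :
    gaussianReal 0 1 ((fun g => m + c * g) ⁻¹' t) =
      ∫⁻ v in t, ENNReal.ofReal (c⁻¹ * stdNormalPDF (c⁻¹ * (v - m))) := by
  have hmap : (gaussianReal 0 1).map (fun g => m + c * g) =
      gaussianReal m (.mk (c ^ 2) (sq_nonneg c) * 1) := by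
    have := Measure.map_map (μ := gaussianReal 0 1) (g := (m + ·)) (f := (c * ·)) (by fun_prop)
      (by fun_prop)
    rw [gaussianReal_map_const_mul, gaussianReal_map_const_add, mul_zero, zero_add] at this
    exact this.symm
  have hv : (NNReal.mk (c ^ 2) (sq_nonneg c) * 1 : ℝ≥0) ≠ 0 := by
    rw [mul_one, ← NNReal.coe_ne_zero]
    exact (pow_pos hc 2).ne'
  rw [← Measure.map_apply (by fun_prop) ht, hmap, gaussianReal_apply _ hv]
  refine lintegral_congr fun v => ?_
  rw [gaussianPDF, stdNormalPDF, gaussianPDFReal_inv_mul hc.ne', abs_of_pos hc,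
    inv_mul_cancel_left₀ hc.ne', mul_zero, gaussianPDFReal_sub, zero_add]

lemma stdNormalPDF_le (z : ℝ) : stdNormalPDF z ≤ (√(2 * Real.pi))⁻¹ := by
  rw [stdNormalPDF, gaussianPDFReal_def]
  simp only [NNReal.coe_one, mul_one]
  exact mul_le_of_le_one_right (by positivity)
    (Real.exp_le_one_iff.2 (div_nonpos_of_nonpos_of_nonneg (by simp [sq_nonneg]) zero_le_two))

lemma integrable_stdNormalPDF_H (p : Params) (F : Factors Ω) (P : Measure Ω) (x : ℝ)
    (κ : Measure ℝ) [IsFiniteMeasure κ] : Integrable (fun u => stdNormalPDF (H p F P x u)) κ := by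
  refine Integrable.of_bound (continuous_stdNormalPDF.comp
    (continuous_H p F P x)).aestronglyMeasurable (√(2 * Real.pi))⁻¹ (ae_of_all _ fun u => ?_)
  rw [Real.norm_of_nonneg (stdNormalPDF_pos _).le]
  exact stdNormalPDF_le _

/-- At x = Φ(v) the factor Φ'(v) cancels the denominator of the density, and the no-jump term and
the mixture term recombine into one integral against the law of J_T. -/
lemma IsFactorModel.stdNormalPDF_mul_limitDensity [IsProbabilityMeasure P] {p : Params}
    (hF : IsFactorModel F p.lam P) (v : ℝ) :
    stdNormalPDF v * limitDensity p F P (stdNormalCDF v) =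
      ∫ u, p.idioVol / |p.aggVol| * stdNormalPDF (H p F P (stdNormalCDF v) u)
        ∂(P.map (compoundPoisson F p.T)) := by
  have hv := (stdNormalPDF_pos v).ne'
  have hint := integrable_stdNormalPDF_H p F P (stdNormalCDF v) (P.map (compoundPoisson F p.T))
  rw [integral_const_mul, limitDensity, stdNormalQuantile_stdNormalCDF,
    Measure.restrict_eq_self_of_ae_mem hF.jumpMixture_ae_nonneg, integral_div]
  rw [hF.map_compoundPoisson_eq_add_jumpMixture] at hint ⊢
  rw [integral_add_measure hint.left_of_add_measure hint.right_of_add_measure,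
    integral_smul_measure, integral_dirac, ENNReal.toReal_ofReal (p.poissonWeight_nonneg 0),
    smul_eq_mul]
  field_simp
  ring

lemma IsFactorModel.aemeasurable_limitingLoss [IsProbabilityMeasure P] {p : Params}
    (hF : IsFactorModel F r P) (hζ : 0 < p.idioVol) : AEMeasurable (limitingLoss p F P) P := by
  refine AEMeasurable.congr ?_ (hF.limitingLoss_ae_eq hζ).symm
  have h1 := hF.measurable_Y p.T
  have h2 := hF.measurable_compoundPoisson p.T
  have h3 : Measurable (defaultLevel p F P) := by
    unfold defaultLevel
    fun_prop
  exact (continuous_stdNormalCDF.measurable.comp (h3.div_const _)).aemeasurable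

/-- Given J_T = u, the standardized level is an affine function of the normal factor; inverting it
at v yields the argument of the normal density. -/
lemma inv_mul_sub_eq_H {p : Params} (hζ : 0 < p.idioVol) (u v : ℝ) :
    (|p.aggVol| / p.idioVol)⁻¹ * (v - (p.totalVol * stdNormalQuantile (noJumpProb p F P)
      + u / √(p.T : ℝ)) / p.idioVol) = H p F P (stdNormalCDF v) u := by
  rw [H, stdNormalQuantile_stdNormalCDF, inv_div]
  field_simp
  ring

lemma IsFactorModel.ofReal_stdNormalPDF_mul_limitDensity [IsProbabilityMeasure P] {p : Params}
    (hF : IsFactorModel F p.lam P) (v : ℝ) :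
    ENNReal.ofReal (stdNormalPDF v) * ENNReal.ofReal (limitDensity p F P (stdNormalCDF v)) =
      ∫⁻ u, ENNReal.ofReal (p.idioVol / |p.aggVol| *
        stdNormalPDF (H p F P (stdNormalCDF v) u)) ∂(P.map (compoundPoisson F p.T)) := by
  have hpos (u : ℝ) : 0 ≤ p.idioVol / |p.aggVol| * stdNormalPDF (H p F P (stdNormalCDF v) u) :=
    mul_nonneg (div_nonneg (Real.sqrt_nonneg _) (abs_nonneg _)) (stdNormalPDF_pos _).le
  rw [← ENNReal.ofReal_mul (stdNormalPDF_pos v).le, hF.stdNormalPDF_mul_limitDensity,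
    ofReal_integral_eq_lintegral_ofReal ((integrable_stdNormalPDF_H p F P _ _).const_mul _)
      (ae_of_all _ hpos)]

/-- Substitution x = Φ(v), with Φ an injective differentiable map of the line onto the unit
interval. -/
lemma lintegral_Ioo_eq_lintegral_stdNormalCDF (f : ℝ → ℝ≥0∞) :
    ∫⁻ x in Ioo (0 : ℝ) 1, f x =
      ∫⁻ v, ENNReal.ofReal (stdNormalPDF v) * f (stdNormalCDF v) := by
  have h := lintegral_image_eq_lintegral_abs_deriv_mul MeasurableSet.univ
    (fun v _ => (hasDerivAt_stdNormalCDF v).hasDerivWithinAt)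
    strictMono_stdNormalCDF.injective.injOn f
  rw [image_univ, range_stdNormalCDF, setLIntegral_univ] at h
  simpa only [abs_of_pos (stdNormalPDF_pos _)] using h

lemma IsFactorModel.map_limitingLoss [IsProbabilityMeasure P] {p : Params}
    (hF : IsFactorModel F p.lam P) (hζ : 0 < p.idioVol) (hΛ : p.aggVol ≠ 0) :
    P.map (limitingLoss p F P) = (volume.restrict (Ioo (0 : ℝ) 1)).withDensity
      (fun x => ENNReal.ofReal (limitDensity p F P x)) := by
  have hc : 0 < |p.aggVol| / p.idioVol := div_pos (abs_pos.2 hΛ) hζ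
  ext s hs
  have ht : MeasurableSet (stdNormalCDF ⁻¹' s) := continuous_stdNormalCDF.measurable hs
  let m (u : ℝ) : ℝ :=
    (p.totalVol * stdNormalQuantile (noJumpProb p F P) + u / √(p.T : ℝ)) / p.idioVol
  have hm : Measurable fun q : ℝ × ℝ => m q.1 + |p.aggVol| / p.idioVol * q.2 := by
    simp only [m]
    fun_prop
  have hset : P (limitingLoss p F P ⁻¹' s) =
      P {ω | (compoundPoisson F p.T ω, normalizedFactor p F ω) ∈
        (fun q : ℝ × ℝ => m q.1 + |p.aggVol| / p.idioVol * q.2) ⁻¹' (stdNormalCDF ⁻¹' s)} := by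
    refine measure_congr (eventuallyEq_set.2 ?_)
    filter_upwards [hF.limitingLoss_ae_eq hζ] with ω hω
    rw [mem_preimage, hω, defaultLevel_div_eq hζ hΛ]
    rfl
  -- Joint measurability for Tonelli. In the variable v the quantile function disappears, so its own
  -- measurability is not needed.
  have hmeas : Measurable fun q : ℝ × ℝ => ENNReal.ofReal (p.idioVol / |p.aggVol| *
      stdNormalPDF (H p F P (stdNormalCDF q.2) q.1)) := by
    have h1 : Measurable fun q : ℝ × ℝ => H p F P (stdNormalCDF q.2) q.1 := by
      simp only [H, stdNormalQuantile_stdNormalCDF]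
      fun_prop
    exact ((continuous_stdNormalPDF.measurable.comp h1).const_mul _).ennreal_ofReal
  rw [Measure.map_apply_of_aemeasurable (hF.aemeasurable_limitingLoss hζ) hs, hset,
    hF.measure_systematic hΛ (hm ht), withDensity_apply _ hs, ← lintegral_indicator hs,
    lintegral_Ioo_eq_lintegral_stdNormalCDF]
  calc ∫⁻ u, gaussianReal 0 1 ((fun g => m u + |p.aggVol| / p.idioVol * g) ⁻¹'
        (stdNormalCDF ⁻¹' s)) ∂(P.map (compoundPoisson F p.T))
      = ∫⁻ u, (∫⁻ v in stdNormalCDF ⁻¹' s, ENNReal.ofReal (p.idioVol / |p.aggVol| *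
          stdNormalPDF (H p F P (stdNormalCDF v) u))) ∂(P.map (compoundPoisson F p.T)) := by
        refine lintegral_congr fun u => ?_
        simp only [gaussianReal_preimage_affine _ hc ht, m, inv_mul_sub_eq_H hζ]
        rw [inv_div]
    _ = ∫⁻ v in stdNormalCDF ⁻¹' s, ∫⁻ u, ENNReal.ofReal (p.idioVol / |p.aggVol| *
          stdNormalPDF (H p F P (stdNormalCDF v) u)) ∂(P.map (compoundPoisson F p.T)) :=
        lintegral_lintegral_swap hmeas.aemeasurable
    _ = _ := by
        rw [← lintegral_indicator ht]
        refine lintegral_congr fun v => ?_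
        classical
        simp only [indicator_apply, mem_preimage]
        split_ifs
        · exact (hF.ofReal_stdNormalPDF_mul_limitDensity v).symm
        · rw [mul_zero]

end Model

end LoanPortfolio

end

theorem proposition2 {Ω : Type*} [MeasurableSpace Ω] (P : Measure Ω) [IsProbabilityMeasure P]
    (p : LoanPortfolio.Params) (F : LoanPortfolio.Factors Ω)
    (hF : LoanPortfolio.IsFactorModel F p.lam P) (hζ : 0 < p.idioVol) :
    -- the limit of the percentage losses exists almost surely and lies strictly between 0 and 1
    (∀ᵐ ω ∂P, Tendsto (fun n => LoanPortfolio.portfolioLoss p F P n ω) atTop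
        (𝓝 (LoanPortfolio.limitingLoss p F P ω))) ∧
    (∀ᵐ ω ∂P, LoanPortfolio.limitingLoss p F P ω ∈ Ioo (0 : ℝ) 1) ∧
    -- the law of the sum of the first k jumps is the k-fold convolution of the jump-size law
    (∀ k, LoanPortfolio.jumpSumLaw F P k = LoanPortfolio.convPow (P.map (F.ξ 0)) k) ∧
    (∀ g : ℝ → ℝ≥0∞, Measurable g → P.map (F.ξ 0) = volume.withDensity g →
      ∀ k, LoanPortfolio.jumpSumLaw F P (k + 1) =
        volume.withDensity (LoanPortfolio.densityConvPow g k)) ∧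
    -- the distribution in the case Λ = 0
    (p.aggVol = 0 → ∀ x ∈ Ioo (0 : ℝ) 1,
      Summable (fun k : ℕ => p.poissonWeight (k + 1) *
        (LoanPortfolio.jumpSumLaw F P (k + 1)).real (Icc 0 (LoanPortfolio.jumpBound p F P x))) ∧
      P.real {ω | LoanPortfolio.limitingLoss p F P ω ≤ x} =
        p.poissonWeight 0 *
            (Icc (LoanPortfolio.noJumpProb p F P) 1).indicator (fun _ => (1 : ℝ)) x
          + ∑' k : ℕ, p.poissonWeight (k + 1) *
            (LoanPortfolio.jumpSumLaw F P (k + 1)).real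
              (Icc 0 (LoanPortfolio.jumpBound p F P x))) ∧
    -- the distribution and its density in the case Λ ≠ 0
    (p.aggVol ≠ 0 →
      (∀ x ∈ Ioo (0 : ℝ) 1,
        Summable (fun k : ℕ => p.poissonWeight (k + 1) *
          ∫ u in Ici (0 : ℝ), LoanPortfolio.stdNormalCDF (LoanPortfolio.H p F P x u)
            ∂(LoanPortfolio.jumpSumLaw F P (k + 1))) ∧
        P.real {ω | LoanPortfolio.limitingLoss p F P ω ≤ x} =
          p.poissonWeight 0 * LoanPortfolio.stdNormalCDF (LoanPortfolio.H p F P x 0)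
            + ∑' k : ℕ, p.poissonWeight (k + 1) *
              ∫ u in Ici (0 : ℝ), LoanPortfolio.stdNormalCDF (LoanPortfolio.H p F P x u)
                ∂(LoanPortfolio.jumpSumLaw F P (k + 1))) ∧
      P.map (LoanPortfolio.limitingLoss p F P) =
        (volume.restrict (Ioo (0 : ℝ) 1)).withDensity
          (fun x => ENNReal.ofReal (LoanPortfolio.limitDensity p F P x))) := by
  refine ⟨?_, hF.limitingLoss_ae_mem_Ioo hζ, hF.jumpSumLaw_eq_convPow,
    fun g hg h k => hF.jumpSumLaw_eq_withDensity hg h k,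
    fun hΛ x hx => hF.limitingLoss_distribution_of_aggVol_eq_zero hζ hΛ hx,
    fun hΛ => ⟨fun x hx => hF.limitingLoss_distribution_of_aggVol_ne_zero hζ hΛ hx,
      hF.map_limitingLoss hζ hΛ⟩⟩
  filter_upwards [hF.ae_tendsto_portfolioLoss hζ, hF.limitingLoss_ae_eq hζ] with ω h h'
  rwa [h']
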